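/- Let $K$ be an algebraically closed field of characteristic zero and let $f\in K[[x,y]]$ be an irreducible power series divisible neither by $x$ nor by $y$, so that $n:=\operatorname{ord}_y f(0,y)$ and $m:=\operatorname{ord}_x f(x,0)$ are positive integers. Definitions. A Newton-Puiseux series in $x$ is an element of $K[[x^{1/\mathbb N}]]:=\bigcup_{N\ge 1}K[[x^{1/N}]]$. For $g\in K[[x,y]]$ with $g(0,y)\neq 0$, let $G\in K[[x]][y]$ be its Weierstrass polynomial relative to $x$, that is, the unique monic polynomial of degree $\operatorname{ord}_y g(0,y)$ such that $g=\epsilon G$ with $\epsilon$ a unit of $K[[x,y]]$; the Newton-Puiseux series of $g$ relative to $x$ are the roots of $G$ in $K[[x^{1/\mathbb N}]]$. Those relative to $y$ are defined by exchanging $x$ and $y$. A representation $\psi=\eta(x^{1/N})$ with $\eta\in K[[t]]$ is primitive if $N$ is the lowest common denominator of the exponents of $\psi$. The dual of a series $\phi\in K[[t]]$ with non-zero constant term is the unique series $\check\phi\in K[[u]]$ with non-zero constant term such that $u\,\check\phi(u)$ is the inverse of $t\,\phi(t)$ for composition. Every Newton-Puiseux series of $f$ relative to $x$ has a primitive representation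 $\eta(x^{1/n})$, with this same $n$, and with $\eta$ of order $m$. Let $E$ be the set of all $\tilde\eta\in K[[t]]$ with non-zero constant term such that $(t\,\tilde\eta(t))^m=\eta(t)$ for some such $\eta$. For $\tilde\eta\in E$ denote by $\tilde\xi$ its dual. Then: 1. The $m$-th roots in $K[[x^{1/\mathbb N}]]$ of the Newton-Puiseux series of $f$ relative to $x$ are exactly the series $x^{1/n}\tilde\eta(x^{1/n})$ with $\tilde\eta\in E$, and the map $$x^{1/n}\,\tilde\eta(x^{1/n})\longmapsto y^{1/m}\,\tilde\xi(y^{1/m})$$ is a well-defined bijection from the set of these $m$-th roots to the set of $n$-th roots in $K[[y^{1/\mathbb N}]]$ of the Newton-Puiseux series of $f$ relative to $y$. 2. Let $\tilde f(t,u):=f(t^n,u^m)\in K[[t,u]]$. The Newton-Puiseux series of $\tilde f$ relative to $t$ are exactly the series $t\,\tilde\eta(t)$ with $\tilde\eta\in E$, and the Newton-Puiseux series of $\tilde f$ relative to $u$ are exactly the series $u\,\tilde\xi(u)$ with $\tilde\eta\in E$. -/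

import Mathlib

open scoped PowerSeries

namespace NewtonPuiseux

noncomputable section

variable {K : Type*} [Field K]

/-- The substitution `η(t) ↦ η(x^{1/n})`, from `K[[t]]` to series in `x` with rational exponents:
the coefficient of `t ^ k` in `η` becomes the coefficient of `x ^ (k / n)`. -/
def fracSubst (n : ℕ+) : K⟦X⟧ →+* HahnSeries ℚ K :=
  (HahnSeries.embDomainRingHom
    ((AddMonoidHom.mulRight ((n : ℚ)⁻¹)).comp (Nat.castAddMonoidHom ℚ))
    (fun a b h => by
      have hn : ((n : ℚ)⁻¹) ≠ 0 := inv_ne_zero (by exact_mod_cast n.ne_zero)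
      simpa [hn] using h)
    (fun a b => by
      have hn : 0 < ((n : ℚ)⁻¹) := inv_pos.mpr (by exact_mod_cast n.pos)
      simp only [AddMonoidHom.comp_apply, AddMonoidHom.mulRight_apply, Nat.coe_castAddMonoidHom]
      rw [mul_le_mul_iff_of_pos_right hn, Nat.cast_le])).comp
    (HahnSeries.toPowerSeries (R := K)).symm.toRingHom

/-- The coefficient of `x ^ (k / n)` in `η(x^{1/n})` is that of `t ^ k` in `η`. -/
theorem coeff_fracSubst (n : ℕ+) (η : K⟦X⟧) (k : ℕ) :
    (fracSubst n η).coeff ((k : ℚ) * (n : ℚ)⁻¹) = PowerSeries.coeff k η :=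
  HahnSeries.embDomain_coeff (x := (HahnSeries.toPowerSeries (R := K)).symm η) (a := k)

/-- Newton-Puiseux series: the elements of `⋃ₙ K[[x^{1/n}]]`. -/
def IsNPSeries (ψ : HahnSeries ℚ K) : Prop :=
  ∃ (n : ℕ+) (η : K⟦X⟧), ψ = fracSubst n η

/-- `ψ = η(x^{1/n})` is a primitive representation: `n` is the lowest common denominator of
the exponents of `ψ`. -/
def IsPrimitiveRep (ψ : HahnSeries ℚ K) (n : ℕ+) (η : K⟦X⟧) : Prop :=
  ψ = fracSubst n η ∧
    IsLeast {N : ℕ+ | ∀ q ∈ ψ.support, ∃ k : ℤ, q = (k : ℚ) / (N : ℚ)} n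

/-- A series in two variables, `X 0 = x` and `X 1 = y`, as a power series in the variable
`X (1 - i)` with coefficients in the ring of power series in the variable `X i`.
So `i = 0` gives `K[[x]][[y]]` and `i = 1` gives `K[[y]][[x]]`. -/
def iterated (i : Fin 2) (f : MvPowerSeries (Fin 2) K) : K⟦X⟧⟦X⟧ :=
  PowerSeries.mk fun b => PowerSeries.mk fun a =>
    MvPowerSeries.coeff (Finsupp.single i a + Finsupp.single (1 - i) b) f

/-- The restriction of `f` to `X i = 0`, a series in the other variable:
`f(0, y)` for `i = 0` and `f(x, 0)` for `i = 1`. -/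
def restrict (i : Fin 2) (f : MvPowerSeries (Fin 2) K) : K⟦X⟧ :=
  (iterated i f).map PowerSeries.constantCoeff

/-- `F` is the Weierstrass polynomial of `f` relative to `X i`. -/
def IsWeierstrassPolynomial (i : Fin 2) (f : MvPowerSeries (Fin 2) K)
    (F : Polynomial K⟦X⟧) : Prop :=
  ∃ ε : K⟦X⟧⟦X⟧, (iterated i f).IsWeierstrassFactorization F ε

/-- The set of Newton-Puiseux series of `f` relative to `X i`: the roots of the Weierstrass
polynomial of `f` relative to `X i` in the ring of Newton-Puiseux series. -/
def npSeries (i : Fin 2) (f : MvPowerSeries (Fin 2) K) : Set (HahnSeries ℚ K) :=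
  {ψ | IsNPSeries ψ ∧ ∃ F, IsWeierstrassPolynomial i f F ∧
    F.eval₂ (HahnSeries.ofPowerSeries ℚ K) ψ = 0}

/-- The Newton-Puiseux series whose `m`-th power is in `S`. -/
def npRoots (m : ℕ+) (S : Set (HahnSeries ℚ K)) : Set (HahnSeries ℚ K) :=
  {φ | IsNPSeries φ ∧ φ ^ (m : ℕ) ∈ S}

theorem isUnit_coeff_one_X_mul (φ : K⟦X⟧ˣ) :
    IsUnit (PowerSeries.coeff 1 (PowerSeries.X * (φ : K⟦X⟧))) := by
  have h := φ.isUnit.map (PowerSeries.constantCoeff (R := K))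
  rw [← PowerSeries.coeff_zero_eq_constantCoeff_apply] at h
  rwa [show (1 : ℕ) = 0 + 1 from rfl, PowerSeries.coeff_succ_X_mul]

/-- The compositional inverse of `t φ(t)`. -/
def reciprocal (φ : K⟦X⟧ˣ) : K⟦X⟧ :=
  (PowerSeries.X * (φ : K⟦X⟧)).substInvOfIsUnit (isUnit_coeff_one_X_mul φ)

theorem isUnit_reciprocal_div (φ : K⟦X⟧ˣ) :
    IsUnit (PowerSeries.mk fun k => PowerSeries.coeff (k + 1) (reciprocal φ)) := by
  rw [PowerSeries.isUnit_iff_constantCoeff, ← PowerSeries.coeff_zero_eq_constantCoeff_apply,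
    PowerSeries.coeff_mk, reciprocal, zero_add, PowerSeries.coeff_one_substInvOfIsUnit]
  exact Units.isUnit _

/-- The dual of a series `φ` with non-zero constant term: the series `φ'` such that `u φ'(u)` is
the compositional inverse of `t φ(t)`. -/
def dual (φ : K⟦X⟧ˣ) : K⟦X⟧ˣ := (isUnit_reciprocal_div φ).unit

theorem X_mul_dual (φ : K⟦X⟧ˣ) : PowerSeries.X * (dual φ : K⟦X⟧) = reciprocal φ := by
  ext k
  cases k with
  | zero =>
    rw [PowerSeries.coeff_zero_X_mul, PowerSeries.coeff_zero_eq_constantCoeff_apply, reciprocal,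
      PowerSeries.constantCoeff_substInvOfIsUnit]
  | succ k => rw [PowerSeries.coeff_succ_X_mul, dual, IsUnit.unit_spec, PowerSeries.coeff_mk]

theorem subst_X_mul_dual (φ : K⟦X⟧ˣ) :
    (PowerSeries.X * (φ : K⟦X⟧)).subst (PowerSeries.X * (dual φ : K⟦X⟧)) =
      (PowerSeries.X : K⟦X⟧) := by
  rw [X_mul_dual]
  exact PowerSeries.subst_substInvOfIsUnit_right _ (by simp) _

theorem X_mul_dual_subst (φ : K⟦X⟧ˣ) :
    (PowerSeries.X * (dual φ : K⟦X⟧)).subst (PowerSeries.X * (φ : K⟦X⟧)) =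
      (PowerSeries.X : K⟦X⟧) := by
  rw [X_mul_dual]
  exact PowerSeries.subst_substInvOfIsUnit_left _ (by simp) _

/-- The series `η̃` with non-zero constant term such that `(t η̃(t)) ^ m = η(t)` for some
Newton-Puiseux series of `f` relative to `x` with primitive representation `η(x^{1/n})`. -/
def etaTilde (f : MvPowerSeries (Fin 2) K) (n m : ℕ+) : Set K⟦X⟧ˣ :=
  {φ | ∃ ψ ∈ npSeries 0 f, ∃ η : K⟦X⟧, IsPrimitiveRep ψ n η ∧
    η = (PowerSeries.X * (φ : K⟦X⟧)) ^ (m : ℕ)}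

/-- The series `f(t ^ n, u ^ m)`. -/
def powSubst (f : MvPowerSeries (Fin 2) K) (n m : ℕ+) : MvPowerSeries (Fin 2) K :=
  MvPowerSeries.subst
    ![(MvPowerSeries.X 0 : MvPowerSeries (Fin 2) K) ^ (n : ℕ), MvPowerSeries.X 1 ^ (m : ℕ)] f

end

end NewtonPuiseux

namespace NewtonPuiseux

noncomputable section

variable {K : Type*} [Field K]

/-! Every assertion reduces to one equation in `K⟦X⟧`, `f(t^n, (t ρ(t))^m) = 0` with `ρ` a unit.
Since the Weierstrass unit stays a unit after evaluation, `η(x^{1/N})` is a Newton-Puiseux series of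
`f` exactly when `η(0) = 0` and `f(t^N, η(t)) = 0` (`fracSubst_mem_npSeries_iff`).

Irreducibility fixes the denominator and the order. If `η(x^{1/N})` is a primitive root, the product
of the `Y - η(ωt)` over `ω^N = 1` descends to `K[[x]][Y]` and divides the Weierstrass polynomial. It
is not a unit, so it equals `f` up to a unit; comparing orders on the two axes gives `N = n` and
`ord η = m` (`order_restrict_of_irreducible`). By Hensel's lemma `η` is then an `m`-th power `(t
ρ)^m`.

Inversion is a change of parameter: with `ξ` the dual of `ρ`, putting `t = u ξ(u)` turns the
equation into `f((u ξ(u))^n, u^m) = 0`, the same equation with the variables exchanged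
(`evalAt_dual`). As duality is an involution, this gives the bijection. Read as `f̃(t, t ρ(t)) = 0`,
the equation describes the roots of `f(t^n, u^m)`. -/

/-! ### Series in two variables as iterated power series -/

theorem fin_two_eq_or (i j : Fin 2) : j = i ∨ j = 1 - i := by
  fin_cases i <;> fin_cases j <;> decide

theorem fin_two_one_sub_ne (i : Fin 2) : 1 - i ≠ i := by
  fin_cases i <;> decide

theorem fin_two_finsupp_eq (i : Fin 2) (e : Fin 2 →₀ ℕ) :
    Finsupp.single i (e i) + Finsupp.single (1 - i) (e (1 - i)) = e := by
  have h := fin_two_one_sub_ne i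
  ext j
  rcases fin_two_eq_or i j with rfl | rfl
  · simp [h]
  · simp [h.symm]

theorem coeff_iterated (i : Fin 2) (f : MvPowerSeries (Fin 2) K) (a b : ℕ) :
    PowerSeries.coeff a (PowerSeries.coeff b (iterated i f)) =
      MvPowerSeries.coeff (Finsupp.single i a + Finsupp.single (1 - i) b) f := by
  simp [iterated]

theorem iterated_mul (i : Fin 2) (f g : MvPowerSeries (Fin 2) K) :
    iterated i (f * g) = iterated i f * iterated i g := by
  have h := fin_two_one_sub_ne i
  ext b a
  rw [coeff_iterated, MvPowerSeries.coeff_mul, PowerSeries.coeff_mul, map_sum]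
  simp only [PowerSeries.coeff_mul, coeff_iterated]
  rw [← Finset.sum_product']
  -- An additive splitting of an exponent pair is an independent splitting of each coordinate.
  refine Finset.sum_nbij' (fun p => ((p.1 (1 - i), p.2 (1 - i)), (p.1 i, p.2 i)))
    (fun q => (Finsupp.single i q.2.1 + Finsupp.single (1 - i) q.1.1,
      Finsupp.single i q.2.2 + Finsupp.single (1 - i) q.1.2)) ?_ ?_ ?_ ?_ ?_
  · rintro ⟨p, q⟩ hp
    rw [Finset.HasAntidiagonal.mem_antidiagonal] at hp
    have h1 := DFunLike.congr_fun hp i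
    have h2 := DFunLike.congr_fun hp (1 - i)
    simp only [Finsupp.add_apply, Finsupp.single_eq_same, Finsupp.single_eq_of_ne h,
      Finsupp.single_eq_of_ne h.symm] at h1 h2
    simp only [Finset.mem_product, Finset.HasAntidiagonal.mem_antidiagonal]
    omega
  · rintro ⟨⟨b₁, b₂⟩, ⟨a₁, a₂⟩⟩ hq
    simp only [Finset.mem_product, Finset.HasAntidiagonal.mem_antidiagonal] at hq ⊢
    rw [← hq.1, ← hq.2, Finsupp.single_add, Finsupp.single_add]
    abel
  · rintro ⟨p, q⟩ -
    simp only [fin_two_finsupp_eq]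
  · rintro ⟨⟨b₁, b₂⟩, ⟨a₁, a₂⟩⟩ -
    simp [h, h.symm]
  · rintro ⟨p, q⟩ -
    simp only [fin_two_finsupp_eq]

/-- `iterated i` as an isomorphism of rings. -/
def iteratedEquiv (i : Fin 2) : MvPowerSeries (Fin 2) K ≃+* K⟦X⟧⟦X⟧ where
  toFun := iterated i
  invFun g := fun e => PowerSeries.coeff (e i) (PowerSeries.coeff (e (1 - i)) g)
  left_inv f := by
    ext e
    change PowerSeries.coeff _ (PowerSeries.coeff _ (iterated i f)) = _
    rw [coeff_iterated, fin_two_finsupp_eq]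
  right_inv g := by
    have h := fin_two_one_sub_ne i
    ext b a
    refine (coeff_iterated i _ a b).trans ?_
    change PowerSeries.coeff _ (PowerSeries.coeff _ g) = _
    simp [h, h.symm]
  map_mul' := iterated_mul i
  map_add' f g := by ext; simp [coeff_iterated]

theorem iteratedEquiv_apply (i : Fin 2) (f : MvPowerSeries (Fin 2) K) :
    iteratedEquiv i f = iterated i f := rfl

theorem coeff_iteratedEquiv_symm (i : Fin 2) (g : K⟦X⟧⟦X⟧) (e : Fin 2 →₀ ℕ) :
    MvPowerSeries.coeff e ((iteratedEquiv i).symm g) =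
      PowerSeries.coeff (e i) (PowerSeries.coeff (e (1 - i)) g) := rfl

theorem iterated_symm (i : Fin 2) (g : K⟦X⟧⟦X⟧) : iterated i ((iteratedEquiv i).symm g) = g :=
  (iteratedEquiv i).apply_symm_apply g

theorem iteratedEquiv_symm_X (i : Fin 2) :
    (iteratedEquiv i).symm (PowerSeries.X : K⟦X⟧⟦X⟧) = MvPowerSeries.X (1 - i) := by
  have h := fin_two_one_sub_ne i
  classical
  ext e
  rw [coeff_iteratedEquiv_symm, MvPowerSeries.coeff_X, PowerSeries.coeff_X]
  have : e = Finsupp.single (1 - i) 1 ↔ e (1 - i) = 1 ∧ e i = 0 := by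
    constructor
    · rintro rfl; simp [h.symm]
    · rintro ⟨h1, h2⟩
      rw [← fin_two_finsupp_eq i e, h1, h2]; simp
  split_ifs <;> simp_all [PowerSeries.coeff_one]

theorem iteratedEquiv_symm_C (i : Fin 2) (c : K⟦X⟧) :
    (iteratedEquiv i).symm (PowerSeries.C c) = c.toMvPowerSeries i := by
  have h := fin_two_one_sub_ne i
  classical
  ext e
  rw [coeff_iteratedEquiv_symm, PowerSeries.toMvPowerSeries_eq_subst,
    PowerSeries.coeff_subst_single, PowerSeries.coeff_C]
  have : e = Finsupp.single i (e i) ↔ e (1 - i) = 0 := by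
    constructor
    · intro he
      have h1 := DFunLike.congr_fun he (1 - i)
      rwa [Finsupp.single_eq_of_ne h] at h1
    · intro h1
      conv_lhs => rw [← fin_two_finsupp_eq i e, h1]
      simp
  simp only [this]
  split_ifs <;> simp

theorem restrict_mul (i : Fin 2) (f g : MvPowerSeries (Fin 2) K) :
    restrict i (f * g) = restrict i f * restrict i g := by
  rw [restrict, iterated_mul, map_mul]; rfl

theorem isUnit_restrict (i : Fin 2) {f : MvPowerSeries (Fin 2) K} (hf : IsUnit f) :
    IsUnit (restrict i f) :=
  (hf.map (iteratedEquiv i)).map (PowerSeries.map PowerSeries.constantCoeff)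

theorem restrict_one_sub (i : Fin 2) (f : MvPowerSeries (Fin 2) K) :
    restrict (1 - i) f = PowerSeries.coeff 0 (iterated i f) := by
  ext k
  rw [coeff_iterated, restrict, PowerSeries.coeff_map,
    ← PowerSeries.coeff_zero_eq_constantCoeff_apply, coeff_iterated, sub_sub_cancel]
  simp

/-! ### Evaluation at a pair of series -/

/-- The value of `f` at `X i = α` and `X (1 - i) = β`, meaningful for series `α` and `β` without
constant term. -/
def evalAt (i : Fin 2) (α β : K⟦X⟧) (f : MvPowerSeries (Fin 2) K) : K⟦X⟧ :=
  MvPowerSeries.subst (fun j => if j = i then α else β) f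

theorem hasSubst_pair (i : Fin 2) {α β : K⟦X⟧} (hα : PowerSeries.constantCoeff α = 0)
    (hβ : PowerSeries.constantCoeff β = 0) :
    MvPowerSeries.HasSubst (fun j => if j = i then α else β : Fin 2 → MvPowerSeries Unit K) := by
  refine MvPowerSeries.hasSubst_of_constantCoeff_zero fun j => ?_
  by_cases h : j = i
  · simp only [h, if_true]; exact hα
  · simp only [h, if_false]; exact hβ

section evalAt

variable (i : Fin 2) {α β : K⟦X⟧}

/-- `evalAt` as a homomorphism of rings. -/
def evalAtHom (hα : PowerSeries.constantCoeff α = 0)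
    (hβ : PowerSeries.constantCoeff β = 0) : MvPowerSeries (Fin 2) K →+* K⟦X⟧ :=
  (MvPowerSeries.substAlgHom (R := K) (hasSubst_pair i hα hβ)).toRingHom

theorem evalAtHom_apply (hα : PowerSeries.constantCoeff α = 0)
    (hβ : PowerSeries.constantCoeff β = 0)
    (f : MvPowerSeries (Fin 2) K) :
    evalAtHom i hα hβ f = evalAt i α β f :=
  MvPowerSeries.substAlgHom_apply (hasSubst_pair i hα hβ) f

theorem evalAt_one_sub (α β : K⟦X⟧) (f : MvPowerSeries (Fin 2) K) :
    evalAt (1 - i) α β f = evalAt i β α f := by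
  unfold evalAt
  congr 1
  funext j
  have h := fin_two_one_sub_ne i
  rcases fin_two_eq_or i j with rfl | rfl
  · simp [h.symm]
  · simp [h]

/-- Both sides are ring homomorphisms in `F`, so it suffices to compare them on constants and on the
variable; no infinite sum has to be handled. -/
theorem evalAtHom_symm_polynomial (hα : PowerSeries.constantCoeff α = 0)
    (hβ : PowerSeries.constantCoeff β = 0)
    (σ : K⟦X⟧ →+* K⟦X⟧) (hσ : ∀ c, σ c = c.subst α)
    (F : Polynomial K⟦X⟧) :
    evalAtHom i hα hβ ((iteratedEquiv i).symm (F : K⟦X⟧⟦X⟧)) = F.eval₂ σ β := by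
  have h := fin_two_one_sub_ne i
  have key : ((evalAtHom i hα hβ).comp (iteratedEquiv i).symm.toRingHom).comp
      Polynomial.coeToPowerSeries.ringHom = Polynomial.eval₂RingHom σ β := by
    refine Polynomial.ringHom_ext (fun c => ?_) ?_
    · simp only [RingHom.comp_apply, Polynomial.coeToPowerSeries.ringHom_apply,
        Polynomial.coe_C, RingEquiv.toRingHom_eq_coe, RingHom.coe_coe, iteratedEquiv_symm_C,
        Polynomial.coe_eval₂RingHom, Polynomial.eval₂_C, hσ, evalAtHom_apply, evalAt]
      refine (PowerSeries.subst_toMvPowerSeries (hasSubst_pair i hα hβ)).trans ?_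
      simp only [if_true]
    · simp only [RingHom.comp_apply, Polynomial.coeToPowerSeries.ringHom_apply,
        Polynomial.coe_X, RingEquiv.toRingHom_eq_coe, RingHom.coe_coe, iteratedEquiv_symm_X,
        Polynomial.coe_eval₂RingHom, Polynomial.eval₂_X, evalAtHom_apply, evalAt]
      refine (MvPowerSeries.subst_X (hasSubst_pair i hα hβ) _).trans ?_
      simp only [h, if_false]
  exact DFunLike.congr_fun key F

theorem evalAt_zero_X (f : MvPowerSeries (Fin 2) K) :
    evalAt i 0 PowerSeries.X f = restrict i f := by
  have hX : PowerSeries.constantCoeff (PowerSeries.X : K⟦X⟧) = 0 := by simp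
  have h0 : PowerSeries.constantCoeff (0 : K⟦X⟧) = 0 := by simp
  -- The roles of the variables are exchanged so that the outer one takes the value `0`: splitting
  -- off the constant coefficient of `g` then leaves a multiple of the outer variable, which
  -- vanishes.
  rw [← sub_sub_cancel 1 i, restrict_one_sub, evalAt_one_sub, ← evalAtHom_apply _ hX h0]
  set g := iterated (1 - i) f with hg
  have hf : f = (iteratedEquiv (1 - i)).symm g := by
    rw [hg, ← iteratedEquiv_apply, RingEquiv.symm_apply_apply]
  have key : g = ((Polynomial.X : Polynomial K⟦X⟧) : K⟦X⟧⟦X⟧) *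
      PowerSeries.mk (fun p => PowerSeries.coeff (p + 1) g) +
      ((Polynomial.C (PowerSeries.coeff 0 g) : Polynomial K⟦X⟧) : K⟦X⟧⟦X⟧) := by
    simpa using PowerSeries.eq_X_mul_shift_add_const g
  rw [hf, key, map_add, map_mul, map_add, map_mul,
    evalAtHom_symm_polynomial (1 - i) hX h0 (RingHom.id _) (fun c => (PowerSeries.X_subst c).symm),
    evalAtHom_symm_polynomial (1 - i) hX h0 (RingHom.id _) (fun c => (PowerSeries.X_subst c).symm)]
  simp

theorem subst_evalAt (hα : PowerSeries.constantCoeff α = 0)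
    (hβ : PowerSeries.constantCoeff β = 0)
    {γ : K⟦X⟧} (hγ : PowerSeries.constantCoeff γ = 0)
    (f : MvPowerSeries (Fin 2) K) :
    (evalAt i α β f).subst γ = evalAt i (α.subst γ) (β.subst γ) f := by
  unfold evalAt PowerSeries.subst
  refine (MvPowerSeries.subst_comp_subst_apply (hasSubst_pair i hα hβ)
    (PowerSeries.HasSubst.const (PowerSeries.HasSubst.of_constantCoeff_zero hγ)) f).trans ?_
  congr 1
  funext j
  split_ifs <;> rfl

theorem evalAt_powSubst (hα : PowerSeries.constantCoeff α = 0)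
    (hβ : PowerSeries.constantCoeff β = 0)
    (f : MvPowerSeries (Fin 2) K) (n m : ℕ+) :
    evalAt 0 α β (powSubst f n m) = evalAt 0 (α ^ (n : ℕ)) (β ^ (m : ℕ)) f := by
  unfold evalAt powSubst
  have h : MvPowerSeries.HasSubst
      ![(MvPowerSeries.X 0 : MvPowerSeries (Fin 2) K) ^ (n : ℕ), MvPowerSeries.X 1 ^ (m : ℕ)] := by
    refine MvPowerSeries.hasSubst_of_constantCoeff_zero fun j => ?_
    fin_cases j <;> simp
  refine (MvPowerSeries.subst_comp_subst_apply h (hasSubst_pair 0 hα hβ) f).trans ?_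
  congr 1
  funext j
  fin_cases j
  · refine (MvPowerSeries.subst_pow (hasSubst_pair 0 hα hβ) _ _).trans ?_
    rw [MvPowerSeries.subst_X (hasSubst_pair 0 hα hβ)]
    rfl
  · refine (MvPowerSeries.subst_pow (hasSubst_pair 0 hα hβ) _ _).trans ?_
    rw [MvPowerSeries.subst_X (hasSubst_pair 0 hα hβ)]
    rfl

end evalAt

/-! ### Series with fractional exponents -/

theorem coeff_fracSubst_of_forall_ne (n : ℕ+) (η : K⟦X⟧) {q : ℚ}
    (hq : ∀ k : ℕ, q ≠ (k : ℚ) * (n : ℚ)⁻¹) : (fracSubst n η).coeff q = 0 := by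
  refine HahnSeries.embDomain_of_notMem_range ?_
  rintro ⟨k, rfl⟩
  exact hq k rfl

theorem fracSubst_injective (n : ℕ+) : Function.Injective (fracSubst (K := K) n) := by
  intro η ξ h
  ext k
  rw [← coeff_fracSubst n, h, coeff_fracSubst]

theorem eq_fracSubst (n : ℕ+) (ψ : HahnSeries ℚ K)
    (h : ∀ q ∈ ψ.support, ∃ k : ℕ, q = (k : ℚ) * (n : ℚ)⁻¹) :
    ψ = fracSubst n (PowerSeries.mk fun k => ψ.coeff ((k : ℚ) * (n : ℚ)⁻¹)) := by
  ext q
  by_cases hq : ∃ k : ℕ, q = (k : ℚ) * (n : ℚ)⁻¹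
  · obtain ⟨k, rfl⟩ := hq
    rw [coeff_fracSubst, PowerSeries.coeff_mk]
  · rw [coeff_fracSubst_of_forall_ne n _ (by simpa using hq)]
    by_contra hne
    exact hq (h q hne)

theorem exists_of_mem_support_fracSubst (n : ℕ+) (η : K⟦X⟧) {q : ℚ}
    (hq : q ∈ (fracSubst n η).support) :
    ∃ k : ℕ, q = (k : ℚ) * (n : ℚ)⁻¹ ∧ PowerSeries.coeff k η ≠ 0 := by
  by_cases h : ∃ k : ℕ, q = (k : ℚ) * (n : ℚ)⁻¹
  · obtain ⟨k, rfl⟩ := h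
    exact ⟨k, rfl, by rwa [HahnSeries.mem_support, coeff_fracSubst] at hq⟩
  · exact absurd (coeff_fracSubst_of_forall_ne n η (by simpa using h)) hq

theorem fracSubst_mul_expand (n d : ℕ+) (η : K⟦X⟧) :
    fracSubst (n * d) (PowerSeries.expand d d.ne_zero η) = fracSubst n η := by
  have hd : ((d : ℕ) : ℚ) ≠ 0 := by exact_mod_cast d.ne_zero
  symm
  rw [eq_fracSubst (n * d) (fracSubst n η)]
  · congr 1
    ext k
    rw [PowerSeries.coeff_mk, PowerSeries.coeff_expand]
    split_ifs with h
    · obtain ⟨l, rfl⟩ := h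
      rw [Nat.mul_div_cancel_left _ d.pos, ← coeff_fracSubst n]
      congr 1
      push_cast
      field_simp
    · refine coeff_fracSubst_of_forall_ne _ _ fun l hl => h ⟨l, ?_⟩
      have hn : ((n : ℕ) : ℚ) ≠ 0 := by exact_mod_cast n.ne_zero
      push_cast at hl
      field_simp at hl
      exact_mod_cast hl
  · intro q hq
    obtain ⟨k, rfl, -⟩ := exists_of_mem_support_fracSubst n η hq
    refine ⟨d * k, ?_⟩
    push_cast
    field_simp

theorem fracSubst_one (η : K⟦X⟧) : fracSubst 1 η = HahnSeries.ofPowerSeries ℚ K η := by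
  rw [fracSubst, HahnSeries.ofPowerSeries]
  congr 2
  ext
  simp
  rfl

theorem ofPowerSeries_eq_fracSubst_expand (n : ℕ+) (η : K⟦X⟧) :
    HahnSeries.ofPowerSeries ℚ K η = fracSubst n (PowerSeries.expand n n.ne_zero η) := by
  rw [← fracSubst_one, ← fracSubst_mul_expand 1 n, one_mul]

theorem eval₂_fracSubst (n : ℕ+) (η : K⟦X⟧) (F : Polynomial K⟦X⟧) :
    F.eval₂ (HahnSeries.ofPowerSeries ℚ K) (fracSubst n η) =
      fracSubst n (F.eval₂ (PowerSeries.expand n n.ne_zero : K⟦X⟧ →ₐ[K] K⟦X⟧).toRingHom η) := by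
  rw [Polynomial.hom_eval₂]
  congr 1
  ext1 c
  exact ofPowerSeries_eq_fracSubst_expand n c

/-! ### Weierstrass polynomials and their roots -/

theorem constantCoeff_eq_zero_iff_mem_maximalIdeal (c : K⟦X⟧) :
    c ∈ IsLocalRing.maximalIdeal K⟦X⟧ ↔ PowerSeries.constantCoeff c = 0 := by
  rw [PowerSeries.maximalIdeal_eq_span_X, Ideal.mem_span_singleton, PowerSeries.X_dvd_iff]

theorem exists_isWeierstrassPolynomial (i : Fin 2) {f : MvPowerSeries (Fin 2) K}
    (hf : restrict i f ≠ 0) : ∃ F, IsWeierstrassPolynomial i f F := by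
  have : IsAdicComplete (IsLocalRing.maximalIdeal K⟦X⟧) K⟦X⟧ := by
    rw [PowerSeries.maximalIdeal_eq_span_X]; infer_instance
  obtain ⟨F, ε, h⟩ := PowerSeries.exists_isWeierstrassFactorization (g := iterated i f) <| by
    intro h
    apply hf
    ext b
    have hb := congrArg (PowerSeries.coeff b) h
    rw [PowerSeries.coeff_map, map_zero, IsLocalRing.residue_eq_zero_iff,
      constantCoeff_eq_zero_iff_mem_maximalIdeal] at hb
    rw [restrict, PowerSeries.coeff_map, hb, map_zero]
  exact ⟨F, ε, h⟩

theorem IsWeierstrassPolynomial.map_constantCoeff {i : Fin 2} {f : MvPowerSeries (Fin 2) K}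
    {F : Polynomial K⟦X⟧} (hF : IsWeierstrassPolynomial i f F) :
    F.map (PowerSeries.constantCoeff (R := K)) = Polynomial.X ^ F.natDegree := by
  obtain ⟨ε, h⟩ := hF
  ext k
  rw [Polynomial.coeff_map, Polynomial.coeff_X_pow]
  split_ifs with hk
  · rw [hk, h.isDistinguishedAt.monic.coeff_natDegree, map_one]
  · rcases lt_or_gt_of_ne hk with hlt | hgt
    · exact (constantCoeff_eq_zero_iff_mem_maximalIdeal _).1 (h.isDistinguishedAt.mem hlt)
    · rw [Polynomial.coeff_eq_zero_of_natDegree_lt hgt, map_zero]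

theorem expand_comp_constantCoeff (n : ℕ) (hn : n ≠ 0) :
    (PowerSeries.constantCoeff (R := K)).comp
      (PowerSeries.expand n hn : K⟦X⟧ →ₐ[K] K⟦X⟧).toRingHom = PowerSeries.constantCoeff := by
  ext1 c; exact PowerSeries.constantCoeff_expand n hn c

/-- Modulo the base variable the polynomial is a pure power of `Y`, so the constant term of a root
is nilpotent. This is what makes substituting the root into `f` legitimate. -/
theorem IsWeierstrassPolynomial.constantCoeff_eq_zero {i : Fin 2} {f : MvPowerSeries (Fin 2) K}
    {F : Polynomial K⟦X⟧} (hF : IsWeierstrassPolynomial i f F) {n : ℕ} (hn : n ≠ 0) {η : K⟦X⟧}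
    (h : F.eval₂ (PowerSeries.expand n hn : K⟦X⟧ →ₐ[K] K⟦X⟧).toRingHom η = 0) :
    PowerSeries.constantCoeff η = 0 := by
  have h1 := congrArg (PowerSeries.constantCoeff (R := K)) h
  rw [Polynomial.hom_eval₂, map_zero] at h1
  rw [expand_comp_constantCoeff, ← Polynomial.eval_map, hF.map_constantCoeff, Polynomial.eval_pow,
    Polynomial.eval_X] at h1
  exact eq_zero_of_pow_eq_zero h1

theorem constantCoeff_X_pow (n : ℕ+) :
    PowerSeries.constantCoeff ((PowerSeries.X : K⟦X⟧) ^ (n : ℕ)) = 0 := by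
  simp

theorem IsWeierstrassPolynomial.evalAt_eq_zero_iff {i : Fin 2} {f : MvPowerSeries (Fin 2) K}
    {F : Polynomial K⟦X⟧} (hF : IsWeierstrassPolynomial i f F) (n : ℕ+) {η : K⟦X⟧}
    (hη : PowerSeries.constantCoeff η = 0) :
    evalAt i (PowerSeries.X ^ (n : ℕ)) η f = 0 ↔
      F.eval₂ (PowerSeries.expand n n.ne_zero : K⟦X⟧ →ₐ[K] K⟦X⟧).toRingHom η = 0 := by
  obtain ⟨ε, h⟩ := hF
  have hf : f = (iteratedEquiv i).symm (F : K⟦X⟧⟦X⟧) * (iteratedEquiv i).symm ε := by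
    rw [← map_mul, ← h.eq_mul, ← iteratedEquiv_apply, RingEquiv.symm_apply_apply]
  have hε : evalAtHom i (constantCoeff_X_pow n) hη ((iteratedEquiv i).symm ε) ≠ 0 :=
    ((h.isUnit.map (iteratedEquiv i).symm).map (evalAtHom i (constantCoeff_X_pow n) hη)).ne_zero
  rw [← evalAtHom_apply i (constantCoeff_X_pow n) hη, hf, map_mul, mul_eq_zero, or_iff_left hε,
    evalAtHom_symm_polynomial i _ _ _ (fun c => PowerSeries.expand_apply n n.ne_zero c)]

theorem fracSubst_mem_npSeries_iff {i : Fin 2} {f : MvPowerSeries (Fin 2) K}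
    (hf : restrict i f ≠ 0) (n : ℕ+) (η : K⟦X⟧) :
    fracSubst n η ∈ npSeries i f ↔
      PowerSeries.constantCoeff η = 0 ∧ evalAt i (PowerSeries.X ^ (n : ℕ)) η f = 0 := by
  constructor
  · rintro ⟨-, F, hF, h⟩
    rw [eval₂_fracSubst, map_eq_zero_iff _ (fracSubst_injective n)] at h
    have hη := hF.constantCoeff_eq_zero _ h
    exact ⟨hη, (hF.evalAt_eq_zero_iff n hη).2 h⟩
  · rintro ⟨hη, h⟩
    obtain ⟨F, hF⟩ := exists_isWeierstrassPolynomial i hf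
    refine ⟨⟨n, η, rfl⟩, F, hF, ?_⟩
    rw [eval₂_fracSubst, (hF.evalAt_eq_zero_iff n hη).1 h, map_zero]

/-! ### Primitive representations -/

theorem IsNPSeries.exists_isPrimitiveRep {ψ : HahnSeries ℚ K} (hψ : IsNPSeries ψ) :
    ∃ n η, IsPrimitiveRep ψ n η := by
  obtain ⟨N, ξ, rfl⟩ := hψ
  set S : Set ℕ+ := {M : ℕ+ | ∀ q ∈ (fracSubst N ξ).support, ∃ k : ℤ, q = (k : ℚ) / (M : ℚ)}
    with hS
  have hne : S.Nonempty := by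
    refine ⟨N, fun q hq => ?_⟩
    obtain ⟨k, rfl, -⟩ := exists_of_mem_support_fracSubst N ξ hq
    exact ⟨k, by push_cast; rw [div_eq_mul_inv]⟩
  have hmin : IsLeast S (wellFounded_lt.min S hne) :=
    ⟨wellFounded_lt.min_mem S hne, fun M hM => wellFounded_lt.min_le hM⟩
  refine ⟨_, _, eq_fracSubst (wellFounded_lt.min S hne) _ fun q hq => ?_, hmin⟩
  obtain ⟨k, hk⟩ := hmin.1 q hq
  obtain ⟨l, hl, -⟩ := exists_of_mem_support_fracSubst N ξ hq
  have hpos : (0 : ℚ) < ((wellFounded_lt.min S hne : ℕ+) : ℕ) := by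
    exact_mod_cast (wellFounded_lt.min S hne).pos
  -- Primitivity allows integer numerators; the exponents are non-negative because `ψ` already comes
  -- from a power series.
  have hk0 : 0 ≤ k := by
    have : 0 ≤ q := by rw [hl]; positivity
    rw [hk, le_div_iff₀ hpos, zero_mul] at this
    exact_mod_cast this
  lift k to ℕ using hk0
  exact ⟨k, by rw [hk, div_eq_mul_inv]; push_cast; rfl⟩

/-- Otherwise `n / d` would be a smaller common denominator. -/
theorem IsPrimitiveRep.eq_one_of_dvd {ψ : HahnSeries ℚ K} {n : ℕ+} {η : K⟦X⟧}
    (h : IsPrimitiveRep ψ n η) {d : ℕ} (hdn : d ∣ (n : ℕ))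
    (hd : ∀ k, PowerSeries.coeff k η ≠ 0 → d ∣ k) : d = 1 := by
  obtain ⟨rfl, hmem, hle⟩ := h
  obtain ⟨e, he⟩ := hdn
  have hn := n.pos
  have he0 : 0 < e := Nat.pos_of_ne_zero (by rintro rfl; simp at he)
  have hd0 : 0 < d := Nat.pos_of_ne_zero (by rintro rfl; simp at he)
  have h1 : n ≤ ⟨e, he0⟩ := by
    refine hle fun q hq => ?_
    obtain ⟨k, rfl, hk⟩ := exists_of_mem_support_fracSubst n η hq
    obtain ⟨l, rfl⟩ := hd k hk
    refine ⟨l, ?_⟩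
    have hn' : ((n : ℕ) : ℚ) = d * e := by exact_mod_cast he
    have h1 : (d : ℚ) ≠ 0 := by exact_mod_cast hd0.ne'
    have h2 : (e : ℚ) ≠ 0 := by exact_mod_cast he0.ne'
    rw [hn', PNat.mk_coe]
    push_cast
    field_simp
  have h2 : (n : ℕ) ≤ e := h1
  rw [he] at h2
  nlinarith

/-! ### Conjugates under roots of unity -/

theorem expand_injective (n : ℕ) (hn : n ≠ 0) :
    Function.Injective (PowerSeries.expand n hn : K⟦X⟧ →ₐ[K] K⟦X⟧) := by
  intro a b h
  ext k
  rw [← PowerSeries.coeff_expand_mul n hn, h, PowerSeries.coeff_expand_mul]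

theorem rescale_expand {n : ℕ} (hn : n ≠ 0) {ω : K} (hω : ω ^ n = 1) (c : K⟦X⟧) :
    PowerSeries.rescale ω (PowerSeries.expand n hn c) = PowerSeries.expand n hn c := by
  ext k
  rw [PowerSeries.coeff_rescale, PowerSeries.coeff_expand]
  split_ifs with h
  · obtain ⟨l, rfl⟩ := h
    rw [pow_mul, hω, one_pow, one_mul]
  · rw [mul_zero]

theorem order_rescale {ω : K} (hω : ω ≠ 0) (η : K⟦X⟧) :
    (PowerSeries.rescale ω η).order = η.order := by
  refine le_antisymm ?_ ?_
  · refine PowerSeries.le_order _ _ fun k hk => ?_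
    have h := PowerSeries.coeff_of_lt_order k hk
    rw [PowerSeries.coeff_rescale] at h
    exact (mul_eq_zero.1 h).resolve_left (pow_ne_zero _ hω)
  · refine PowerSeries.le_order _ _ fun k hk => ?_
    rw [PowerSeries.coeff_rescale, PowerSeries.coeff_of_lt_order k hk, mul_zero]

/-- Invariance under `t ↦ ζt` forces `ζ^k = 1` for every exponent `k` that occurs, hence `n ∣ k`. -/
theorem exists_expand_eq_of_rescale_eq {n : ℕ} (hn : n ≠ 0) {ζ : K} (hζ : IsPrimitiveRoot ζ n)
    {c : K⟦X⟧} (hc : PowerSeries.rescale ζ c = c) : ∃ b, PowerSeries.expand n hn b = c := by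
  refine ⟨PowerSeries.mk fun k => PowerSeries.coeff (n * k) c, ?_⟩
  ext k
  rw [PowerSeries.coeff_expand]
  split_ifs with h
  · obtain ⟨l, rfl⟩ := h
    rw [Nat.mul_div_cancel_left _ (Nat.pos_of_ne_zero hn), PowerSeries.coeff_mk]
  · have h1 := congrArg (PowerSeries.coeff k) hc
    rw [PowerSeries.coeff_rescale] at h1
    have h2 : (ζ ^ k - 1) * PowerSeries.coeff k c = 0 := by rw [sub_mul, h1, one_mul, sub_self]
    rcases mul_eq_zero.1 h2 with h3 | h3
    · exact absurd ((hζ.pow_eq_one_iff_dvd k).1 (sub_eq_zero.1 h3)) h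
    · exact h3.symm

/-- The product of the `Y - η(ω t)` over the `n`-th roots of unity `ω`. -/
def conjugateProd (n : ℕ) (η : K⟦X⟧) : Polynomial K⟦X⟧ :=
  ∏ ω ∈ Polynomial.nthRootsFinset n (1 : K),
    (Polynomial.X - Polynomial.C (PowerSeries.rescale ω η))

theorem conjugateProd_monic (n : ℕ) (η : K⟦X⟧) : (conjugateProd n η).Monic :=
  Polynomial.monic_prod_of_monic _ _ fun _ _ => Polynomial.monic_X_sub_C _

/-- Multiplication by `ζ` permutes the `n`-th roots of unity, hence the factors. -/
theorem map_rescale_conjugateProd {n : ℕ} (hn : 0 < n) (η : K⟦X⟧) {ζ : K} (hζ : ζ ^ n = 1) :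
    (conjugateProd n η).map (PowerSeries.rescale ζ) = conjugateProd n η := by
  have hζ0 : ζ ≠ 0 := by
    rintro rfl
    rw [zero_pow hn.ne'] at hζ
    exact zero_ne_one hζ
  rw [conjugateProd, Polynomial.map_prod]
  refine Finset.prod_bij' (fun ω _ => ω * ζ) (fun ω _ => ω * ζ⁻¹) ?_ ?_ ?_ ?_ ?_
  · intro ω hω
    rw [Polynomial.mem_nthRootsFinset hn] at hω ⊢
    rw [mul_pow, hω, hζ, one_mul]
  · intro ω hω
    rw [Polynomial.mem_nthRootsFinset hn] at hω ⊢
    rw [mul_pow, hω, inv_pow, hζ, inv_one, one_mul]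
  · intro ω _
    rw [mul_inv_cancel_right₀ hζ0]
  · intro ω _
    rw [inv_mul_cancel_right₀ hζ0]
  · intro ω _
    rw [Polynomial.map_sub, Polynomial.map_X, Polynomial.map_C, PowerSeries.rescale_rescale]

theorem exists_map_expand_eq_conjugateProd {n : ℕ} (hn : n ≠ 0) {ζ : K}
    (hζ : IsPrimitiveRoot ζ n) (η : K⟦X⟧) :
    ∃ G : Polynomial K⟦X⟧,
      G.map (PowerSeries.expand n hn : K⟦X⟧ →ₐ[K] K⟦X⟧).toRingHom = conjugateProd n η ∧
        G.natDegree = n ∧ G.Monic := by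
  have hlift : conjugateProd n η ∈
      Polynomial.lifts (PowerSeries.expand n hn : K⟦X⟧ →ₐ[K] K⟦X⟧).toRingHom := by
    rw [Polynomial.lifts_iff_coeff_lifts]
    intro k
    obtain ⟨b, hb⟩ := exists_expand_eq_of_rescale_eq hn hζ (c := (conjugateProd n η).coeff k)
      (by rw [← Polynomial.coeff_map,
        map_rescale_conjugateProd (Nat.pos_of_ne_zero hn) η hζ.pow_eq_one])
    exact ⟨b, hb⟩
  obtain ⟨G, h1, h2, h3⟩ :=
    Polynomial.lifts_and_natDegree_eq_and_monic hlift (conjugateProd_monic n η)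
  refine ⟨G, h1, ?_, h3⟩
  rw [h2, conjugateProd, Polynomial.natDegree_prod_of_monic _ _ fun _ _ =>
    Polynomial.monic_X_sub_C _]
  simp [hζ.card_nthRootsFinset]

/-- If two conjugates coincide, the order of `ω / ω'` divides `n` and every exponent of `η`, so it
is `1` by primitivity. -/
theorem IsPrimitiveRep.injOn_rescale {ψ : HahnSeries ℚ K} {n : ℕ+} {η : K⟦X⟧}
    (h : IsPrimitiveRep ψ n η) :
    Set.InjOn (fun ω : K => PowerSeries.rescale ω η)
      (Polynomial.nthRootsFinset (n : ℕ) (1 : K)) := by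
  intro ω hω ω' hω' heq
  rw [Finset.mem_coe, Polynomial.mem_nthRootsFinset n.pos] at hω hω'
  have hω0 : ω' ≠ 0 := by
    rintro rfl
    rw [zero_pow n.ne_zero] at hω'
    exact zero_ne_one hω'
  have h1 : orderOf (ω / ω') = 1 := by
    refine h.eq_one_of_dvd (orderOf_dvd_of_pow_eq_one ?_) fun k hk => ?_
    · rw [div_pow, hω, hω', div_one]
    · refine orderOf_dvd_of_pow_eq_one ?_
      have h2 := congrArg (PowerSeries.coeff k) heq
      simp only [PowerSeries.coeff_rescale] at h2
      rw [div_pow, mul_right_cancel₀ hk h2, div_self (pow_ne_zero _ hω0)]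
  rw [orderOf_eq_one_iff, div_eq_one_iff_eq hω0] at h1
  exact h1

/-- The remainder of `F` modulo `G` has degree less than `n` but vanishes at the `n` distinct
conjugates of `η`, so it is zero. -/
theorem dvd_of_map_expand_eq_conjugateProd {ψ : HahnSeries ℚ K} {n : ℕ+} {η : K⟦X⟧}
    (h : IsPrimitiveRep ψ n η) {ζ : K} (hζ : IsPrimitiveRoot ζ n) {F G : Polynomial K⟦X⟧}
    (hG : G.map (PowerSeries.expand n n.ne_zero : K⟦X⟧ →ₐ[K] K⟦X⟧).toRingHom =
      conjugateProd n η) (hdeg : G.natDegree = n) (hmonic : G.Monic)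
    (hF : F.eval₂ (PowerSeries.expand n n.ne_zero : K⟦X⟧ →ₐ[K] K⟦X⟧).toRingHom η = 0) :
    G ∣ F := by
  classical
  set σ := (PowerSeries.expand n n.ne_zero : K⟦X⟧ →ₐ[K] K⟦X⟧).toRingHom with hσ
  have hσinj : Function.Injective σ := expand_injective n n.ne_zero
  have hroot : ∀ H : Polynomial K⟦X⟧, H.eval₂ σ η = 0 →
      ∀ ω ∈ Polynomial.nthRootsFinset (n : ℕ) (1 : K),
        H.eval₂ σ (PowerSeries.rescale ω η) = 0 := by
    intro H hH ω hω
    rw [Polynomial.mem_nthRootsFinset n.pos] at hω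
    have h1 := Polynomial.hom_eval₂ H σ (PowerSeries.rescale ω) η
    rw [hH, map_zero] at h1
    have h2 : (PowerSeries.rescale ω).comp σ = σ := by
      ext1 c; exact rescale_expand n.ne_zero hω c
    rw [h2] at h1
    exact h1.symm
  have hGη : G.eval₂ σ η = 0 := by
    rw [← Polynomial.eval_map, hG, conjugateProd, Polynomial.eval_prod]
    refine Finset.prod_eq_zero (i := 1) ?_ ?_
    · rw [Polynomial.mem_nthRootsFinset n.pos, one_pow]
    · simp
  rw [← Polynomial.modByMonic_eq_zero_iff_dvd hmonic]
  have hR : (F %ₘ G).eval₂ σ η = 0 := by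
    have := congrArg (Polynomial.eval₂ σ η) (Polynomial.modByMonic_add_div F G)
    rwa [Polynomial.eval₂_add, Polynomial.eval₂_mul, hGη, hF, zero_mul, add_zero] at this
  have hG1 : G ≠ 1 := by
    rintro rfl
    rw [Polynomial.natDegree_one] at hdeg
    exact n.ne_zero hdeg.symm
  apply Polynomial.map_injective σ hσinj
  rw [Polynomial.map_zero]
  refine Polynomial.eq_zero_of_natDegree_lt_card_of_eval_eq_zero' _
    ((Polynomial.nthRootsFinset (n : ℕ) (1 : K)).image fun ω => PowerSeries.rescale ω η) ?_ ?_
  · intro x hx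
    obtain ⟨ω, hω, rfl⟩ := Finset.mem_image.1 hx
    rw [Polynomial.eval_map]
    exact hroot _ hR ω hω
  · rw [Finset.card_image_of_injOn h.injOn_rescale, hζ.card_nthRootsFinset]
    refine lt_of_le_of_lt Polynomial.natDegree_map_le ?_
    rw [← hdeg]
    exact Polynomial.natDegree_modByMonic_lt F hmonic hG1

/-! ### Irreducibility: the denominator and the order of a root -/

theorem order_restrict_of_irreducible [IsAlgClosed K] [CharZero K] {i : Fin 2}
    {f : MvPowerSeries (Fin 2) K} (hf : Irreducible f) (hfi : restrict i f ≠ 0)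
    {ψ : HahnSeries ℚ K} {n : ℕ+} {η : K⟦X⟧} (h : IsPrimitiveRep ψ n η)
    (hη : PowerSeries.constantCoeff η = 0)
    (hroot : evalAt i (PowerSeries.X ^ (n : ℕ)) η f = 0) :
    (restrict i f).order = ((n : ℕ) : ℕ∞) ∧ (restrict (1 - i) f).order = η.order := by
  obtain ⟨ζ, hζ⟩ := HasEnoughRootsOfUnity.exists_primitiveRoot K (n : ℕ)
  obtain ⟨F, hF⟩ := exists_isWeierstrassPolynomial i hfi
  obtain ⟨G, hG, hdeg, hmonic⟩ := exists_map_expand_eq_conjugateProd n.ne_zero hζ η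
  obtain ⟨Q, hQ⟩ := dvd_of_map_expand_eq_conjugateProd h hζ hG hdeg hmonic
    ((hF.evalAt_eq_zero_iff n hη).1 hroot)
  obtain ⟨ε, hε⟩ := hF
  set g := (iteratedEquiv i).symm (G : K⟦X⟧⟦X⟧) with hg
  set u := (iteratedEquiv i).symm ((Q : K⟦X⟧⟦X⟧) * ε) with hu
  have hfgu : f = g * u := by
    rw [hg, hu, ← map_mul, ← mul_assoc, ← Polynomial.coe_mul, ← hQ, ← hε.eq_mul,
      ← iteratedEquiv_apply, RingEquiv.symm_apply_apply]
  have hGY : G.map (PowerSeries.constantCoeff (R := K)) = Polynomial.X ^ (n : ℕ) := by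
    rw [← expand_comp_constantCoeff n n.ne_zero, ← Polynomial.map_map, hG, conjugateProd,
      Polynomial.map_prod]
    simp [← PowerSeries.coeff_zero_eq_constantCoeff_apply, PowerSeries.coeff_rescale,
      hζ.card_nthRootsFinset, hη]
  have hgi : restrict i g = PowerSeries.X ^ (n : ℕ) := by
    rw [restrict, hg, iterated_symm, ← Polynomial.polynomial_map_coe, hGY, Polynomial.coe_pow,
      Polynomial.coe_X]
  have hgnu : ¬ IsUnit g := fun hgu => by
    have := isUnit_restrict i hgu
    rw [hgi, isUnit_pow_iff n.ne_zero] at this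
    exact PowerSeries.X_prime.not_isUnit this
  have huu : IsUnit u := (hf.isUnit_or_isUnit hfgu).resolve_left hgnu
  refine ⟨?_, ?_⟩
  · rw [hfgu, restrict_mul, PowerSeries.order_mul,
      PowerSeries.order_zero_of_unit (isUnit_restrict i huu), add_zero, hgi,
      PowerSeries.order_X_pow]
  · rw [hfgu, restrict_mul, PowerSeries.order_mul,
      PowerSeries.order_zero_of_unit (isUnit_restrict _ huu), add_zero, restrict_one_sub, hg,
      iterated_symm, Polynomial.coeff_coe]
    -- The constant coefficient of `G`, read in `t` with `x = t^n`, is up to sign the product of the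
    -- `n` conjugates. Its order is thus both `n · ord (G.coeff 0)` and `n · ord η`, and `n`
    -- cancels.
    have h1 : PowerSeries.expand n n.ne_zero (G.coeff 0) =
        ∏ ω ∈ Polynomial.nthRootsFinset (n : ℕ) (1 : K), -PowerSeries.rescale ω η := by
      have h2 := congrArg (Polynomial.eval 0) hG
      rw [← Polynomial.coeff_zero_eq_eval_zero, Polynomial.coeff_map, conjugateProd,
        Polynomial.eval_prod] at h2
      simpa using h2
    have h3 := congrArg PowerSeries.order h1
    have h4 : ∀ ω ∈ Polynomial.nthRootsFinset (n : ℕ) (1 : K),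
        (-PowerSeries.rescale ω η).order = η.order := by
      intro ω hω
      rw [Polynomial.mem_nthRootsFinset n.pos] at hω
      rw [PowerSeries.order_neg, order_rescale]
      rintro rfl
      rw [zero_pow n.ne_zero] at hω
      exact zero_ne_one hω
    rw [PowerSeries.order_expand, PowerSeries.order_prod, Finset.sum_congr rfl h4,
      Finset.sum_const, hζ.card_nthRootsFinset, nsmul_eq_mul, nsmul_eq_mul] at h3
    exact (ENat.mul_right_strictMono (by exact_mod_cast n.ne_zero) (ENat.natCast_ne_top _)).injective h3

theorem exists_isPrimitiveRep_of_irreducible [IsAlgClosed K] [CharZero K] {i : Fin 2}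
    {f : MvPowerSeries (Fin 2) K} (hf : Irreducible f) {n m : ℕ+}
    (hn : (restrict i f).order = ((n : ℕ) : ℕ∞))
    (hm : (restrict (1 - i) f).order = ((m : ℕ) : ℕ∞)) {ψ : HahnSeries ℚ K}
    (hψ : ψ ∈ npSeries i f) :
    ∃ η : K⟦X⟧, IsPrimitiveRep ψ n η ∧ η.order = ((m : ℕ) : ℕ∞) := by
  have hfi : restrict i f ≠ 0 := by
    intro h0
    rw [h0, PowerSeries.order_zero] at hn
    exact ENat.top_ne_natCast _ hn
  obtain ⟨N, η, h⟩ := hψ.1.exists_isPrimitiveRep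
  rw [h.1, fracSubst_mem_npSeries_iff hfi] at hψ
  obtain ⟨h1, h2⟩ := order_restrict_of_irreducible hf hfi h hψ.1 hψ.2
  rw [hn] at h1
  rw [hm] at h2
  obtain rfl : n = N := PNat.coe_injective (by exact_mod_cast h1)
  exact ⟨η, h, h2.symm⟩

/-! ### Extraction of roots -/

/-- Hensel's lemma for `Y^m - u`, starting from an `m`-th root `z` of the constant term: the root is
simple because `m z^(m-1) ≠ 0` in characteristic zero. -/
theorem exists_pow_eq_of_isUnit [IsAlgClosed K] [CharZero K] (m : ℕ+) {u : K⟦X⟧}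
    (hu : IsUnit u) : ∃ ρ : K⟦X⟧ˣ, (ρ : K⟦X⟧) ^ (m : ℕ) = u := by
  have hu0 : PowerSeries.constantCoeff u ≠ 0 := (PowerSeries.isUnit_iff_constantCoeff.1 hu).ne_zero
  obtain ⟨z, hz⟩ := IsAlgClosed.exists_pow_nat_eq (PowerSeries.constantCoeff u) m.pos
  have hz0 : z ≠ 0 := by
    rintro rfl
    rw [zero_pow m.ne_zero] at hz
    exact hu0 hz.symm
  have hm0 : ((m : ℕ) : K) ≠ 0 := by exact_mod_cast m.ne_zero
  have : HenselianRing K⟦X⟧ (Ideal.span {PowerSeries.X}) := inferInstance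
  obtain ⟨a, ha, -⟩ := this.is_henselian (Polynomial.X ^ (m : ℕ) - Polynomial.C u)
    (Polynomial.monic_X_pow_sub_C u m.ne_zero) (PowerSeries.C z)
    (by
      rw [Ideal.mem_span_singleton, PowerSeries.X_dvd_iff]
      simp [hz])
    (by
      refine IsUnit.map _ (PowerSeries.isUnit_iff_constantCoeff.2 (IsUnit.mk0 _ ?_))
      rw [Polynomial.derivative_sub, Polynomial.derivative_C, Polynomial.derivative_X_pow]
      simp [hz0, hm0])
  have hau : a ^ (m : ℕ) = u := by
    simpa [Polynomial.IsRoot, sub_eq_zero] using ha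
  have haunit : IsUnit a := by rw [← isUnit_pow_iff m.ne_zero, hau]; exact hu
  exact ⟨haunit.unit, hau⟩

theorem exists_X_mul_pow_eq_of_order_eq [IsAlgClosed K] [CharZero K] (m : ℕ+) {η : K⟦X⟧}
    (h : η.order = ((m : ℕ) : ℕ∞)) :
    ∃ ρ : K⟦X⟧ˣ, (PowerSeries.X * (ρ : K⟦X⟧)) ^ (m : ℕ) = η := by
  have hdvd : (PowerSeries.X : K⟦X⟧) ^ (m : ℕ) ∣ η :=
    PowerSeries.X_pow_dvd_iff.2 fun k hk =>
      PowerSeries.coeff_of_lt_order k (by rw [h]; exact_mod_cast hk)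
  obtain ⟨u, rfl⟩ := hdvd
  have hu : IsUnit u := by
    rw [PowerSeries.isUnit_iff_constantCoeff, isUnit_iff_ne_zero]
    have h1 := (PowerSeries.order_eq_nat.1 h).1
    rwa [← PowerSeries.coeff_zero_eq_constantCoeff_apply, ← PowerSeries.coeff_X_pow_mul u m 0,
      zero_add]
  obtain ⟨ρ, hρ⟩ := exists_pow_eq_of_isUnit m hu
  exact ⟨ρ, by rw [mul_pow, hρ]⟩

/-- Two `m`-th roots in the field of Hahn series differ by a root of unity, which is a constant of
`K` and is absorbed into the unit `ρ`. -/
theorem exists_unit_of_pow_eq [IsAlgClosed K] [CharZero K] (n m : ℕ+) (ρ : K⟦X⟧ˣ)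
    {φ : HahnSeries ℚ K}
    (h : φ ^ (m : ℕ) = fracSubst n (PowerSeries.X * (ρ : K⟦X⟧)) ^ (m : ℕ)) :
    ∃ ρ' : K⟦X⟧ˣ, φ = fracSubst n (PowerSeries.X * (ρ' : K⟦X⟧)) ∧
      (PowerSeries.X * (ρ' : K⟦X⟧)) ^ (m : ℕ) = (PowerSeries.X * (ρ : K⟦X⟧)) ^ (m : ℕ) := by
  obtain ⟨ζ, hζ⟩ := HasEnoughRootsOfUnity.exists_primitiveRoot K (m : ℕ)
  set τ : K →+* HahnSeries ℚ K := (fracSubst n).comp (PowerSeries.C (R := K)) with hτ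
  have hζ' : IsPrimitiveRoot (τ ζ) (m : ℕ) := hζ.map_of_injective τ.injective
  set χ := fracSubst n (PowerSeries.X * (ρ : K⟦X⟧)) with hχ
  have hχ0 : χ ≠ 0 := by
    rw [hχ, Ne, map_eq_zero_iff _ (fracSubst_injective n)]
    exact mul_ne_zero PowerSeries.X_ne_zero ρ.ne_zero
  obtain ⟨j, -, hj⟩ := hζ'.eq_pow_of_pow_eq_one (ξ := φ / χ)
    (by rw [div_pow, h, div_self (pow_ne_zero _ hχ0)])
  have hζ0 : ζ ≠ 0 := hζ.ne_zero m.ne_zero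
  have hunit : IsUnit (PowerSeries.C (ζ ^ j) * (ρ : K⟦X⟧)) :=
    ((IsUnit.mk0 _ (pow_ne_zero j hζ0)).map (PowerSeries.C (R := K))).mul ρ.isUnit
  have hφ : φ = fracSubst n (PowerSeries.X * (hunit.unit : K⟦X⟧)) := by
    rw [IsUnit.unit_spec, mul_left_comm, map_mul, ← hχ, ← RingHom.comp_apply, ← hτ, map_pow, hj,
      div_mul_cancel₀ _ hχ0]
  refine ⟨hunit.unit, hφ, fracSubst_injective n ?_⟩
  exact (map_pow _ _ _).trans
    ((congrArg (· ^ (m : ℕ)) hφ.symm).trans (h.trans (map_pow _ _ _).symm))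

theorem constantCoeff_X_mul_pow (m : ℕ+) (ρ : K⟦X⟧) :
    PowerSeries.constantCoeff ((PowerSeries.X * ρ) ^ (m : ℕ)) = 0 := by
  simp

theorem ne_zero_of_order_eq {η : K⟦X⟧} {n : ℕ} (h : η.order = (n : ℕ∞)) : η ≠ 0 := by
  rintro rfl
  rw [PowerSeries.order_zero] at h
  exact ENat.top_ne_natCast _ h

theorem mem_npRoots_iff [IsAlgClosed K] [CharZero K] {i : Fin 2}
    {f : MvPowerSeries (Fin 2) K} (hf : Irreducible f) {n m : ℕ+}
    (hn : (restrict i f).order = ((n : ℕ) : ℕ∞))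
    (hm : (restrict (1 - i) f).order = ((m : ℕ) : ℕ∞)) {φ : HahnSeries ℚ K} :
    φ ∈ npRoots m (npSeries i f) ↔ ∃ ρ : K⟦X⟧ˣ,
      φ = fracSubst n (PowerSeries.X * (ρ : K⟦X⟧)) ∧
        evalAt i (PowerSeries.X ^ (n : ℕ)) ((PowerSeries.X * (ρ : K⟦X⟧)) ^ (m : ℕ)) f = 0 := by
  have hfi := ne_zero_of_order_eq hn
  constructor
  · rintro ⟨-, h⟩
    obtain ⟨η, ⟨hrep, -⟩, hη⟩ := exists_isPrimitiveRep_of_irreducible hf hn hm h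
    obtain ⟨ρ, rfl⟩ := exists_X_mul_pow_eq_of_order_eq m hη
    rw [map_pow] at hrep
    obtain ⟨ρ', hφ, hρ'⟩ := exists_unit_of_pow_eq n m ρ hrep
    refine ⟨ρ', hφ, ?_⟩
    rw [hφ, ← map_pow, fracSubst_mem_npSeries_iff hfi] at h
    exact h.2
  · rintro ⟨ρ, rfl, h⟩
    refine ⟨⟨n, _, rfl⟩, ?_⟩
    rw [← map_pow, fracSubst_mem_npSeries_iff hfi]
    exact ⟨constantCoeff_X_mul_pow m _, h⟩

/-- Primitivity with denominator `n` is automatic for roots of an irreducible `f`, so only the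
equation remains. -/
theorem mem_etaTilde_iff [IsAlgClosed K] [CharZero K] {f : MvPowerSeries (Fin 2) K}
    (hf : Irreducible f) {n m : ℕ+} (hn : (restrict 0 f).order = ((n : ℕ) : ℕ∞))
    (hm : (restrict 1 f).order = ((m : ℕ) : ℕ∞)) {ρ : K⟦X⟧ˣ} :
    ρ ∈ etaTilde f n m ↔
      evalAt 0 (PowerSeries.X ^ (n : ℕ)) ((PowerSeries.X * (ρ : K⟦X⟧)) ^ (m : ℕ)) f = 0 := by
  have hfi := ne_zero_of_order_eq hn
  constructor
  · rintro ⟨ψ, hψ, η, ⟨rfl, -⟩, rfl⟩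
    exact ((fracSubst_mem_npSeries_iff hfi _ _).1 hψ).2
  · intro h
    have hmem := (fracSubst_mem_npSeries_iff hfi n _).2 ⟨constantCoeff_X_mul_pow m _, h⟩
    obtain ⟨η, hη, -⟩ := exists_isPrimitiveRep_of_irreducible hf hn hm hmem
    exact ⟨_, hmem, η, hη, (fracSubst_injective n hη.1).symm⟩

/-! ### Duality -/

theorem hasSubst_X_mul (ρ : K⟦X⟧) : PowerSeries.HasSubst (PowerSeries.X * ρ) :=
  PowerSeries.HasSubst.of_constantCoeff_zero' (by simp)

theorem dual_dual (ρ : K⟦X⟧ˣ) : dual (dual ρ) = ρ := by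
  ext1
  refine mul_left_cancel₀ (PowerSeries.X_ne_zero (R := K)) ?_
  have h := congrArg (PowerSeries.subst (PowerSeries.X * (dual (dual ρ) : K⟦X⟧)))
    (subst_X_mul_dual ρ)
  rw [PowerSeries.subst_comp_subst_apply (hasSubst_X_mul _) (hasSubst_X_mul _),
    subst_X_mul_dual (dual ρ), PowerSeries.X_subst, PowerSeries.subst_X (hasSubst_X_mul _)] at h
  exact h.symm

/-- Substitute `t = u ξ(u)` with `ξ = dual ρ`: then `t^n` becomes `(u ξ)^n` and `t ρ(t)` becomes
`u`. -/
theorem evalAt_dual {i : Fin 2} {f : MvPowerSeries (Fin 2) K} {n m : ℕ+} {ρ : K⟦X⟧ˣ}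
    (h : evalAt i (PowerSeries.X ^ (n : ℕ)) ((PowerSeries.X * (ρ : K⟦X⟧)) ^ (m : ℕ)) f = 0) :
    evalAt (1 - i) (PowerSeries.X ^ (m : ℕ))
      ((PowerSeries.X * (dual ρ : K⟦X⟧)) ^ (n : ℕ)) f = 0 := by
  have hs := hasSubst_X_mul (dual ρ : K⟦X⟧)
  have h1 := congrArg (PowerSeries.subst (PowerSeries.X * (dual ρ : K⟦X⟧))) h
  rw [subst_evalAt i (constantCoeff_X_pow n) (constantCoeff_X_mul_pow m _) (by simp),
    PowerSeries.subst_pow hs, PowerSeries.subst_pow hs, PowerSeries.subst_X hs,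
    subst_X_mul_dual, ← PowerSeries.coe_substAlgHom hs, map_zero] at h1
  rwa [evalAt_one_sub]

/-! ### Roots after the substitution of powers -/

/-- Stating the relation between `g` and `f` through values keeps it symmetric, so it serves for
both variables. The point is that the roots of `g` have integer exponents. -/
theorem mem_npSeries_iff_of_evalAt_pow [IsAlgClosed K] [CharZero K] {i : Fin 2}
    {f g : MvPowerSeries (Fin 2) K} (hf : Irreducible f) {n m : ℕ+}
    (hn : (restrict i f).order = ((n : ℕ) : ℕ∞))
    (hm : (restrict (1 - i) f).order = ((m : ℕ) : ℕ∞))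
    (hg : ∀ α β : K⟦X⟧, PowerSeries.constantCoeff α = 0 → PowerSeries.constantCoeff β = 0 →
      evalAt i α β g = evalAt i (α ^ (n : ℕ)) (β ^ (m : ℕ)) f) {ψ : HahnSeries ℚ K} :
    ψ ∈ npSeries i g ↔ ∃ ρ : K⟦X⟧ˣ,
      ψ = HahnSeries.ofPowerSeries ℚ K (PowerSeries.X * (ρ : K⟦X⟧)) ∧
        evalAt i (PowerSeries.X ^ (n : ℕ)) ((PowerSeries.X * (ρ : K⟦X⟧)) ^ (m : ℕ)) f = 0 := by
  have hfi := ne_zero_of_order_eq hn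
  have hgi : restrict i g ≠ 0 := by
    have hX : PowerSeries.HasSubst ((PowerSeries.X : K⟦X⟧) ^ (m : ℕ)) :=
      PowerSeries.HasSubst.X_pow m.ne_zero
    have h : restrict i g = PowerSeries.expand m m.ne_zero (restrict i f) := by
      rw [← evalAt_zero_X, hg _ _ (map_zero _) PowerSeries.constantCoeff_X,
        zero_pow n.ne_zero, PowerSeries.expand_apply, ← evalAt_zero_X,
        subst_evalAt i (map_zero _) PowerSeries.constantCoeff_X (constantCoeff_X_pow m),
        PowerSeries.subst_X hX, ← PowerSeries.coe_substAlgHom hX, map_zero]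
    rw [h, Ne, map_eq_zero_iff _ (expand_injective m m.ne_zero)]
    exact hfi
  constructor
  · rintro h
    obtain ⟨N, η, rfl⟩ := h.1
    obtain ⟨hη, h⟩ := (fracSubst_mem_npSeries_iff hgi N η).1 h
    rw [hg _ _ (constantCoeff_X_pow N) hη, ← pow_mul, mul_comm, ← PNat.mul_coe] at h
    -- A root `η(t^{1/N})` of `g` becomes, with `t = x^{1/n}`, an `m`-th root of a root of `f`. Such
    -- roots have denominator `n`, so `η` is a series in the `N`-th power of its variable.
    have hmem : fracSubst (n * N) η ∈ npRoots m (npSeries i f) := by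
      refine ⟨⟨_, _, rfl⟩, ?_⟩
      rw [← map_pow, fracSubst_mem_npSeries_iff hfi]
      exact ⟨by rw [map_pow, hη, zero_pow m.ne_zero], h⟩
    obtain ⟨ρ, h1, h2⟩ := (mem_npRoots_iff hf hn hm).1 hmem
    rw [← fracSubst_mul_expand n N] at h1
    exact ⟨ρ, by rw [ofPowerSeries_eq_fracSubst_expand N, fracSubst_injective _ h1], h2⟩
  · rintro ⟨ρ, rfl, h⟩
    rw [← fracSubst_one, fracSubst_mem_npSeries_iff hgi,
      hg _ _ (constantCoeff_X_pow 1) (by simp), PNat.one_coe, pow_one]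
    exact ⟨by simp, h⟩

end

end NewtonPuiseux

/-! ### The inversion theorem -/

open NewtonPuiseux in
theorem mainTheorem9 {K : Type*} [Field K] [IsAlgClosed K] [CharZero K]
    (f : MvPowerSeries (Fin 2) K) (hf : Irreducible f) (n m : ℕ+)
    (hn : (NewtonPuiseux.restrict 0 f).order = ((n : ℕ) : ℕ∞))
    (hm : (NewtonPuiseux.restrict 1 f).order = ((m : ℕ) : ℕ∞)) :
    -- every Newton-Puiseux series relative to `x` is primitively `η(x^{1/n})` with `ord η = m`
    (∀ ψ ∈ NewtonPuiseux.npSeries 0 f, ∃ η : K⟦X⟧,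
      NewtonPuiseux.IsPrimitiveRep ψ n η ∧ η.order = ((m : ℕ) : ℕ∞)) ∧
    -- the `m`-th roots of these series are exactly the series `x^{1/n} η̃(x^{1/n})`
    NewtonPuiseux.npRoots m (NewtonPuiseux.npSeries 0 f) =
      {φ | ∃ η' ∈ NewtonPuiseux.etaTilde f n m,
        φ = NewtonPuiseux.fracSubst n (PowerSeries.X * (η' : K⟦X⟧))} ∧
    -- the map `x^{1/n} η̃(x^{1/n}) ↦ y^{1/m} ξ̃(y^{1/m})` is well defined and bijective
    (∃ Φ : HahnSeries ℚ K → HahnSeries ℚ K,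
      (∀ η' ∈ NewtonPuiseux.etaTilde f n m,
        Φ (NewtonPuiseux.fracSubst n (PowerSeries.X * (η' : K⟦X⟧))) =
          NewtonPuiseux.fracSubst m (PowerSeries.X * (NewtonPuiseux.dual η' : K⟦X⟧))) ∧
      Set.BijOn Φ (NewtonPuiseux.npRoots m (NewtonPuiseux.npSeries 0 f))
        (NewtonPuiseux.npRoots n (NewtonPuiseux.npSeries 1 f))) ∧
    -- the series `t η̃(t)` are the Newton-Puiseux series of `f(t ^ n, u ^ m)` relative to `t`
    NewtonPuiseux.npSeries 0 (NewtonPuiseux.powSubst f n m) =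
      {φ | ∃ η' ∈ NewtonPuiseux.etaTilde f n m,
        φ = HahnSeries.ofPowerSeries ℚ K (PowerSeries.X * (η' : K⟦X⟧))} ∧
    -- the series `u ξ̃(u)` are the Newton-Puiseux series of `f(t ^ n, u ^ m)` relative to `u`
    NewtonPuiseux.npSeries 1 (NewtonPuiseux.powSubst f n m) =
      {φ | ∃ η' ∈ NewtonPuiseux.etaTilde f n m,
        φ = HahnSeries.ofPowerSeries ℚ K
          (PowerSeries.X * (NewtonPuiseux.dual η' : K⟦X⟧))} := by
  have heta : ∀ ρ : K⟦X⟧ˣ, ρ ∈ etaTilde f n m ↔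
      evalAt 0 (PowerSeries.X ^ (n : ℕ)) ((PowerSeries.X * (ρ : K⟦X⟧)) ^ (m : ℕ)) f = 0 :=
    fun _ => mem_etaTilde_iff hf hn hm
  have hetaDual : ∀ ρ : K⟦X⟧ˣ, dual ρ ∈ etaTilde f n m ↔
      evalAt 1 (PowerSeries.X ^ (m : ℕ)) ((PowerSeries.X * (ρ : K⟦X⟧)) ^ (n : ℕ)) f = 0 := by
    intro ρ
    rw [heta]
    refine ⟨fun h => ?_, fun h => evalAt_dual (i := 1) h⟩
    have := evalAt_dual h
    rwa [dual_dual] at this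
  have hroots0 : npRoots m (npSeries 0 f) =
      {φ | ∃ η' ∈ etaTilde f n m, φ = fracSubst n (PowerSeries.X * (η' : K⟦X⟧))} := by
    ext φ
    rw [mem_npRoots_iff hf hn hm, Set.mem_ofPred_eq]
    exact exists_congr fun ρ => by rw [heta, and_comm]
  have hroots1 : npRoots n (npSeries 1 f) =
      {φ | ∃ ρ : K⟦X⟧ˣ, dual ρ ∈ etaTilde f n m ∧
        φ = fracSubst m (PowerSeries.X * (ρ : K⟦X⟧))} := by
    ext φ
    rw [mem_npRoots_iff hf (i := 1) hm hn, Set.mem_ofPred_eq]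
    exact exists_congr fun ρ => by rw [hetaDual, and_comm]
  have hinj : ∀ k : ℕ+, Function.Injective
      (fun ρ : K⟦X⟧ˣ => fracSubst k (PowerSeries.X * (ρ : K⟦X⟧))) := fun k ρ ρ' h =>
    Units.ext (mul_left_cancel₀ PowerSeries.X_ne_zero (fracSubst_injective k h))
  refine ⟨fun ψ hψ => exists_isPrimitiveRep_of_irreducible hf hn hm hψ, hroots0, ?_, ?_, ?_⟩
  -- `Φ` is well defined because the series determines `ρ`; the value `0` elsewhere is irrelevant.
  · set Φ : HahnSeries ℚ K → HahnSeries ℚ K := Function.extend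
      (fun ρ : K⟦X⟧ˣ => fracSubst n (PowerSeries.X * (ρ : K⟦X⟧)))
      (fun ρ => fracSubst m (PowerSeries.X * (dual ρ : K⟦X⟧))) 0 with hΦdef
    have hΦ : ∀ ρ : K⟦X⟧ˣ, Φ (fracSubst n (PowerSeries.X * (ρ : K⟦X⟧))) =
        fracSubst m (PowerSeries.X * (dual ρ : K⟦X⟧)) := fun ρ => (hinj n).extend_apply _ _ ρ
    refine ⟨Φ, fun ρ _ => hΦ ρ, ?_⟩
    rw [hroots0, hroots1]
    refine ⟨?_, ?_, ?_⟩
    · rintro _ ⟨ρ, hρ, rfl⟩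
      exact ⟨dual ρ, by rwa [dual_dual], hΦ ρ⟩
    · rintro _ ⟨ρ, -, rfl⟩ _ ⟨ρ', -, rfl⟩ h
      rw [hΦ, hΦ] at h
      have := hinj m h
      rw [← dual_dual ρ, this, dual_dual]
    · rintro _ ⟨ρ, hρ, rfl⟩
      exact ⟨_, ⟨dual ρ, hρ, rfl⟩, by rw [hΦ, dual_dual]⟩
  · ext φ
    rw [mem_npSeries_iff_of_evalAt_pow hf hn hm
      (fun α β hα hβ => evalAt_powSubst hα hβ f n m), Set.mem_ofPred_eq]
    exact exists_congr fun ρ => by rw [heta, and_comm]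
  · ext φ
    rw [mem_npSeries_iff_of_evalAt_pow (i := 1) hf hm hn (fun α β hα hβ => by
      exact (evalAt_one_sub 0 α β _).trans ((evalAt_powSubst hβ hα f n m).trans
        (evalAt_one_sub 0 _ _ f).symm)), Set.mem_ofPred_eq]
    constructor
    · rintro ⟨ρ, rfl, h⟩
      exact ⟨dual ρ, (hetaDual ρ).2 h, by rw [dual_dual]⟩
    · rintro ⟨ρ, hρ, rfl⟩
      exact ⟨dual ρ, rfl, (hetaDual _).1 (by rwa [dual_dual])⟩
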